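/- Let $V$ be a finite set of $n \ge 2$ vertices, let $E(K_n)$ denote the edge set of the complete graph on $V$, let $E_{\mathrm{init}} \subseteq E(K_n)$ be such that the base graph $(V, E_{\mathrm{init}})$ is connected, and let $w : E(K_n) \to \mathbb{R}_{>0}$ be an arbitrary positive weight function. For a graph $G = (V,E)$ with $E \subseteq E(K_n)$, let $$t_w(G) = \sum_{T} \prod_{e \in E(T)} w(e)$$ be its weighted number of spanning trees, the sum being over all spanning trees $T$ of $G$, and let $\tau_w(G) = \log t_w(G)$ if $t_w(G) > 0$ and $\tau_w(G) = 0$ otherwise. Define the tree-connectivity gain on subsets $E \subseteq E(K_n)$ by $$\mathsf{logTG}_{n,w}(E) = \tau_w\big((V, E \cup E_{\mathrm{init}})\big) - \tau_w\big((V, E_{\mathrm{init}})\big).$$ Then $\mathsf{logTG}_{n,w}$ is 1. normalized: $\mathsf{logTG}_{n,w}(\varnothing) = 0$; 2. monotone: $\mathsf{logTG}_{n,w}(A) \le \mathsf{logTG}_{n,w}(B)$ whenever $A \subseteq B \subseteq E(K_n)$; 3. submodular: $\mathsf{logTG}_{n,w}(A \cup \{s\}) - \mathsf{logTG}_{n,w}(A)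 \ge \mathsf{logTG}_{n,w}(B \cup \{s\}) - \mathsf{logTG}_{n,w}(B)$ whenever $A \subseteq B \subseteq E(K_n)$ and $s \in E(K_n) \setminus B$. -/

import Mathlib

namespace TreeConnectivity

/-- The edge set `E(K_V)` of the complete graph on the vertex set `V`, as a type. -/
abbrev CompleteEdge (V : Type*) : Type _ := {e : Sym2 V // e ∈ (⊤ : SimpleGraph V).edgeSet}

/-- The simple graph `G_E = (V, E)` given by a set `E ⊆ E(K_V)` of edges. -/
def graphOf {V : Type*} (E : Finset (CompleteEdge V)) : SimpleGraph V :=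
  SimpleGraph.fromEdgeSet (Subtype.val '' (E : Set (CompleteEdge V)))

open scoped Classical in
/-- The finite set of spanning trees of `G`; a spanning subgraph of `G` is a graph `T ≤ G` on the
same vertex type. -/
noncomputable def spanningTrees {V : Type*} [Fintype V] (G : SimpleGraph V) :
    Finset (SimpleGraph V) :=
  {T : SimpleGraph V | T ≤ G ∧ T.IsTree}

open scoped Classical in
/-- The value of a graph `T`: the product of the weights of its edges. -/
noncomputable def treeValue {V : Type*} [Fintype V] (w : CompleteEdge V → ℝ)
    (T : SimpleGraph V) : ℝ :=
  ∏ e : CompleteEdge V with e.1 ∈ T.edgeSet, w e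

/-- The weighted number of spanning trees `t_w(G)`. -/
noncomputable def weightedTreeCount {V : Type*} [Fintype V] (w : CompleteEdge V → ℝ)
    (G : SimpleGraph V) : ℝ :=
  ∑ T ∈ spanningTrees G, treeValue w T

open scoped Classical in
/-- The weighted tree-connectivity `τ_w(G)`: `log t_w(G)` if `t_w(G) > 0`, and `0` otherwise. -/
noncomputable def treeConnectivity {V : Type*} [Fintype V] (w : CompleteEdge V → ℝ)
    (G : SimpleGraph V) : ℝ :=
  if 0 < weightedTreeCount w G then Real.log (weightedTreeCount w G) else 0

/-- The tree-connectivity gain over the base edge set `Einit`. -/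
noncomputable def logTG {V : Type*} [Fintype V] [DecidableEq V] (Einit : Finset (CompleteEdge V))
    (w : CompleteEdge V → ℝ) (E : Finset (CompleteEdge V)) : ℝ :=
  treeConnectivity w (graphOf (E ∪ Einit)) - treeConnectivity w (graphOf Einit)

/-- A set function is normalized if it vanishes on the empty set. -/
def IsNormalized {α : Type*} (ξ : Finset α → ℝ) : Prop :=
  ξ ∅ = 0

/-- A set function is monotone if `ξ A ≤ ξ B` whenever `A ⊆ B`. -/
def IsMonotone {α : Type*} (ξ : Finset α → ℝ) : Prop :=
  ∀ A B : Finset α, A ⊆ B → ξ A ≤ ξ B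

/-- A set function is submodular if it has diminishing marginal gains. -/
def IsSubmodular {α : Type*} [DecidableEq α] (ξ : Finset α → ℝ) : Prop :=
  ∀ A B : Finset α, A ⊆ B → ∀ s ∉ B, ξ (B ∪ {s}) - ξ B ≤ ξ (A ∪ {s}) - ξ A

end TreeConnectivity

/-!
Fix a root `r` and orient the edges. By Kirchhoff's matrix-tree theorem the weighted number of
spanning trees of `(V, E)` is the determinant of the reduced Laplacian
`L E = ∑ e ∈ E, w e • u e (u e)ᵀ`, where `u e` is the incidence vector of `e` with the entry at `r`
deleted (`weightedTreeCount_eq_det`). This follows from the Cauchy–Binet formula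
(`det_gram_eq_sum_powersetCard`) and from total unimodularity: `|V| - 1` incidence vectors have
determinant `± 1` when the edges form a tree (`det_gram_incVec_eq_one`) and `0` otherwise
(`det_gram_incVec_eq_zero`).

For connected `(V, E)` the matrix `L E` is positive definite, and by the matrix determinant lemma a
new edge `s` multiplies its determinant by `1 + w s * (u s)ᵀ (L E)⁻¹ (u s)`
(`det_gram_insert`). As the inverse is antitone for the Loewner order
(`dotProduct_gram_inv_antitone`), this factor can only decrease when `E` grows; its logarithm is
the marginal gain of `s`, so the gain is submodular. Monotonicity holds because a larger graph has
more spanning trees and every tree has positive value.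
-/

open Matrix

namespace TreeConnectivity

/-! ### The Cauchy–Binet expansion of a weighted Gram determinant -/

section Gram

variable {ι n R : Type*} [Fintype n] [DecidableEq n] [CommRing R]

/-- The weighted Gram matrix `∑ e ∈ E, w e • u e (u e)ᵀ` of a family of vectors `u`. -/
def gram (u : ι → n → R) (w : ι → R) (E : Finset ι) : Matrix n n R :=
  ∑ e ∈ E, w e • vecMulVec (u e) (u e)

omit [Fintype n] [DecidableEq n] in
theorem gram_apply (u : ι → n → R) (w : ι → R) (E : Finset ι) (i j : n) :
    gram u w E i j = ∑ e ∈ E, w e * (u e i * u e j) := by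
  simp [gram, Matrix.sum_apply, vecMulVec_apply]

omit [DecidableEq n] in
theorem dotProduct_gram_mulVec (u : ι → n → R) (w : ι → R) (E : Finset ι) (x y : n → R) :
    x ⬝ᵥ (gram u w E *ᵥ y) = ∑ e ∈ E, w e * ((u e ⬝ᵥ x) * (u e ⬝ᵥ y)) := by
  simp only [gram, sum_mulVec, dotProduct_sum, smul_mulVec, vecMulVec_mulVec, dotProduct_smul]
  refine Finset.sum_congr rfl fun e _ => ?_
  rw [dotProduct_comm x (u e), smul_eq_mul, MulOpposite.smul_eq_mul_unop, MulOpposite.unop_op]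

/-- Expanding every row of the Gram matrix gives a sum over all choices of one vector per row;
choices with a repetition have determinant zero. -/
theorem det_gram_eq_sum_piFinset [DecidableEq ι] (u : ι → n → R) (w : ι → R) (E : Finset ι) :
    (gram u w E).det =
      ∑ f ∈ (Fintype.piFinset fun _ : n => E) with Function.Injective f,
        (∏ i, w (f i)) * ((∏ i, u (f i) i) * (of fun i => u (f i)).det) := by
  have hrow : gram u w E = of fun i => ∑ e ∈ E, (w e * u e i) • u e := by
    ext i j
    simp [gram_apply, Finset.sum_apply, mul_assoc]
  have hexp : (gram u w E).det = ∑ f ∈ Fintype.piFinset fun _ : n => E,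
      (∏ i, w (f i)) * ((∏ i, u (f i) i) * (of fun i => u (f i)).det) := by
    rw [hrow]
    refine ((detRowAlternating (R := R) (n := n)).toMultilinearMap.map_sum_finset
      (fun i e => (w e * u e i) • u e) fun _ => E).trans ?_
    refine Finset.sum_congr rfl fun f _ => ?_
    refine ((detRowAlternating (R := R) (n := n)).toMultilinearMap.map_smul_univ
      (fun i => w (f i) * u (f i) i) fun i => u (f i)).trans ?_
    rw [Finset.prod_mul_distrib, smul_eq_mul, mul_assoc]
    rfl
  rw [hexp, Finset.sum_filter]
  refine Finset.sum_congr rfl fun f _ => ?_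
  split_ifs with hf
  · rfl
  · obtain ⟨i, j, hij, hne⟩ : ∃ i j, f i = f j ∧ i ≠ j := by
      simpa [Function.Injective] using hf
    rw [det_zero_of_row_eq hne (congrArg u hij), mul_zero, mul_zero]

/-- A form of the Cauchy–Binet formula: the squared maximal minors appear as the determinants of
the unweighted Gram matrices of the subfamilies of size `n`. -/
theorem det_gram_eq_sum_powersetCard [DecidableEq ι] (u : ι → n → R) (w : ι → R) (E : Finset ι) :
    (gram u w E).det =
      ∑ S ∈ E.powersetCard (Fintype.card n), (∏ e ∈ S, w e) * (gram u 1 S).det := by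
  rw [det_gram_eq_sum_piFinset]
  have himage : ∀ f ∈ (Fintype.piFinset fun _ : n => E).filter Function.Injective,
      Finset.univ.image f ∈ E.powersetCard (Fintype.card n) := by
    intro f hf
    simp only [Finset.mem_filter, Fintype.mem_piFinset] at hf
    rw [Finset.mem_powersetCard, Finset.card_image_of_injective _ hf.2, Finset.card_univ]
    exact ⟨Finset.image_subset_iff.2 fun i _ => hf.1 i, rfl⟩
  rw [← Finset.sum_fiberwise_of_maps_to himage]
  refine Finset.sum_congr rfl fun S hS => ?_
  rw [Finset.mem_powersetCard] at hS
  rw [det_gram_eq_sum_piFinset, Finset.mul_sum]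
  refine Finset.sum_congr ?_ fun f hf => ?_
  -- An injective choice with values in `S` has image `S`, since `S` has `n` elements.
  · ext f
    simp only [Finset.mem_filter, Fintype.mem_piFinset]
    constructor
    · rintro ⟨⟨_, hinj⟩, rfl⟩
      exact ⟨fun i => Finset.mem_image_of_mem _ (Finset.mem_univ i), hinj⟩
    · rintro ⟨hfS, hinj⟩
      refine ⟨⟨fun i => hS.1 (hfS i), hinj⟩, Finset.eq_of_subset_of_card_le
        (Finset.image_subset_iff.2 fun i _ => hfS i) ?_⟩
      rw [Finset.card_image_of_injective _ hinj, Finset.card_univ, hS.2]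
  · simp only [Finset.mem_filter, Fintype.mem_piFinset] at hf
    have hf' : Finset.univ.image f = S := by
      refine Finset.eq_of_subset_of_card_le (Finset.image_subset_iff.2 fun i _ => hf.1 i) ?_
      rw [Finset.card_image_of_injective _ hf.2, Finset.card_univ, hS.2]
    rw [← hf', Finset.prod_image fun i _ j _ h => hf.2 h]
    simp

/-- The Gram determinant of `n` vectors is the square of the determinant of these vectors. -/
theorem det_gram_one_eq_sq (u : ι → n → R) (S : Finset ι) (g : n ≃ S) :
    (gram u 1 S).det = (of fun i => u (g i)).det ^ 2 := by
  have h : gram u 1 S = (of fun i => u (g i))ᵀ * of fun i => u (g i) := by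
    ext i j
    rw [gram_apply, mul_apply, ← Finset.sum_coe_sort S, ← g.sum_comp]
    simp
  rw [h, det_mul, det_transpose, sq]

theorem det_gram_insert {K : Type*} [Field K] [DecidableEq ι] (u : ι → n → K) (w : ι → K)
    {E : Finset ι} {s : ι} (hs : s ∉ E) (hE : (gram u w E).det ≠ 0) :
    (gram u w (insert s E)).det =
      (gram u w E).det * (1 + w s * (u s ⬝ᵥ ((gram u w E)⁻¹ *ᵥ u s))) := by
  have h : gram u w (insert s E) =
      gram u w E + replicateCol Unit (w s • u s) * replicateRow Unit (u s) := by
    rw [gram, Finset.sum_insert hs, add_comm, ← gram]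
    congr 1
    ext i j
    simp [mul_apply, vecMulVec_apply, mul_assoc]
  rw [h, det_add_replicateCol_mul_replicateRow (isUnit_iff_ne_zero.2 hE)]
  congr 1
  rw [Matrix.mul_assoc, ← replicateCol_mulVec, mulVec_smul, det_unique, Matrix.add_apply,
    one_apply_eq, mul_apply]
  simp [dotProduct, Finset.mul_sum, mul_left_comm]

/-- The inverse is antitone on positive definite Gram matrices: for `x = B⁻¹ v` and `y = A⁻¹ v`,
expanding `0 ≤ (x - y)ᵀ A (x - y)` and using `xᵀ A x ≤ xᵀ B x` gives `vᵀ x ≤ vᵀ y`. -/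
theorem dotProduct_gram_inv_antitone (u : ι → n → ℝ) (w : ι → ℝ) (hw : ∀ e, 0 < w e)
    {A B : Finset ι} (hAB : A ⊆ B) (hA : (gram u w A).det ≠ 0) (hB : (gram u w B).det ≠ 0)
    (v : n → ℝ) :
    v ⬝ᵥ ((gram u w B)⁻¹ *ᵥ v) ≤ v ⬝ᵥ ((gram u w A)⁻¹ *ᵥ v) := by
  set x := (gram u w B)⁻¹ *ᵥ v with hx
  set y := (gram u w A)⁻¹ *ᵥ v with hy
  have hBx : gram u w B *ᵥ x = v := by
    rw [hx, mulVec_mulVec, mul_nonsing_inv _ (isUnit_iff_ne_zero.2 hB), one_mulVec]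
  have hAy : gram u w A *ᵥ y = v := by
    rw [hy, mulVec_mulVec, mul_nonsing_inv _ (isUnit_iff_ne_zero.2 hA), one_mulVec]
  have h1 : x ⬝ᵥ (gram u w A *ᵥ x) ≤ x ⬝ᵥ (gram u w B *ᵥ x) := by
    rw [dotProduct_gram_mulVec, dotProduct_gram_mulVec]
    exact Finset.sum_le_sum_of_subset_of_nonneg hAB fun e _ _ =>
      mul_nonneg (hw e).le (mul_self_nonneg _)
  have h2 : 0 ≤ (x - y) ⬝ᵥ (gram u w A *ᵥ (x - y)) := by
    rw [dotProduct_gram_mulVec]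
    exact Finset.sum_nonneg fun e _ => mul_nonneg (hw e).le (mul_self_nonneg _)
  have h3 : y ⬝ᵥ (gram u w A *ᵥ x) = x ⬝ᵥ (gram u w A *ᵥ y) := by
    simp only [dotProduct_gram_mulVec, mul_comm (u _ ⬝ᵥ y)]
  rw [mulVec_sub, sub_dotProduct, dotProduct_sub, dotProduct_sub, h3, hAy] at h2
  rw [hBx] at h1
  rw [dotProduct_comm v x, dotProduct_comm v y]
  linarith

end Gram

/-! ### The reduced incidence vectors -/

section Incidence

variable {V : Type*} [DecidableEq V]

/-- The row of the edge `e` in the oriented incidence matrix, with the column of the root `r`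
deleted. Each edge is oriented by a choice of representative of the unordered pair. -/
noncomputable def incVec (R : Type*) [Ring R] (r : V) (e : CompleteEdge V) (i : {v : V // v ≠ r}) :
    R :=
  (if (Quot.out e.1).1 = i then 1 else 0) - if (Quot.out e.1).2 = i then 1 else 0

omit [DecidableEq V] in
theorem mk_out (e : CompleteEdge V) : s((Quot.out e.1).1, (Quot.out e.1).2) = e.1 :=
  Quot.out_eq e.1

theorem incVec_dotProduct [Fintype V] {R : Type*} [Ring R] {r : V} (e : CompleteEdge V)
    (X : V → R) (hX : X r = 0) :
    (incVec R r e ⬝ᵥ fun i : {v : V // v ≠ r} => X i) =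
      X (Quot.out e.1).1 - X (Quot.out e.1).2 := by
  have key : ∀ a : V, ∑ i : {v : V // v ≠ r}, (if a = i then (1 : R) else 0) * X i = X a := by
    intro a
    by_cases ha : a = r
    · rw [ha, hX]
      exact Finset.sum_eq_zero fun i _ => by rw [if_neg (Ne.symm i.2), zero_mul]
    · rw [Finset.sum_eq_single ⟨a, ha⟩]
      · simp
      · intro i _ hi
        rw [if_neg fun h => hi (Subtype.ext h.symm), zero_mul]
      · simp
  simp only [dotProduct, incVec, sub_mul, Finset.sum_sub_distrib, key]

omit [DecidableEq V] in
theorem graphOf_adj {E : Finset (CompleteEdge V)} {a b : V} :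
    (graphOf E).Adj a b ↔ ∃ e ∈ E, e.1 = s(a, b) := by
  simp only [graphOf, SimpleGraph.fromEdgeSet_adj, Set.mem_image, Finset.mem_coe]
  refine ⟨fun h => h.1, ?_⟩
  rintro ⟨e, he, hab⟩
  refine ⟨⟨e, he, hab⟩, ?_⟩
  have := e.2
  rw [hab] at this
  simpa using this

omit [DecidableEq V] in
theorem mem_edgeSet_graphOf {E : Finset (CompleteEdge V)} {e : CompleteEdge V} :
    e.1 ∈ (graphOf E).edgeSet ↔ e ∈ E := by
  rw [← mk_out e, SimpleGraph.mem_edgeSet, graphOf_adj, mk_out]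
  exact ⟨fun ⟨_, hd, h⟩ => Subtype.ext h ▸ hd, fun h => ⟨e, h, rfl⟩⟩

omit [DecidableEq V] in
theorem graphOf_mono {A B : Finset (CompleteEdge V)} (h : A ⊆ B) : graphOf A ≤ graphOf B := by
  intro a b hab
  obtain ⟨e, he, h'⟩ := graphOf_adj.1 hab
  exact graphOf_adj.2 ⟨e, h he, h'⟩

omit [DecidableEq V] in
theorem ncard_edgeSet_graphOf (S : Finset (CompleteEdge V)) :
    Nat.card (graphOf S).edgeSet = S.card := by
  have h : (graphOf S).edgeSet = Subtype.val '' (S : Set (CompleteEdge V)) := by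
    ext e
    constructor
    · intro he
      have he' : e ∈ (⊤ : SimpleGraph V).edgeSet := SimpleGraph.edgeSet_mono le_top he
      exact ⟨⟨e, he'⟩, mem_edgeSet_graphOf.1 he, rfl⟩
    · rintro ⟨e, he, rfl⟩
      exact mem_edgeSet_graphOf.2 he
  rw [h, Nat.card_coe_set_eq, Set.ncard_image_of_injective _ Subtype.val_injective,
    Set.ncard_coe_finset]

omit [DecidableEq V] in
/-- A potential without drop along the edges of a connected graph is constant. -/
theorem eq_of_connected_of_edge_eq {R : Type*} {E : Finset (CompleteEdge V)}
    (hE : (graphOf E).Connected) (X : V → R)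
    (hX : ∀ e ∈ E, X (Quot.out e.1).1 = X (Quot.out e.1).2) (a b : V) : X a = X b := by
  have hadj : ∀ a b, (graphOf E).Adj a b → X a = X b := by
    intro a b hab
    obtain ⟨e, he, h⟩ := graphOf_adj.1 hab
    rw [← mk_out e, Sym2.eq_iff] at h
    rcases h with ⟨h1, h2⟩ | ⟨h1, h2⟩
    · rw [← h1, ← h2, hX e he]
    · rw [← h1, ← h2, hX e he]
  obtain ⟨p⟩ := hE.preconnected a b
  induction p with
  | nil => rfl
  | cons h _ ih => exact (hadj _ _ h).trans ih

variable [Fintype V]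

/-- The Laplacian of a weighted graph, with the row and column of the root deleted, is positive
definite when the graph is connected; only the positivity of the determinant is recorded. -/
theorem det_gram_incVec_pos {E : Finset (CompleteEdge V)} (hE : (graphOf E).Connected)
    {w : CompleteEdge V → ℝ} (hw : ∀ e, 0 < w e) (r : V) :
    0 < (gram (incVec ℝ r) w E).det := by
  refine PosDef.det_pos (PosDef.of_dotProduct_mulVec_pos ?_ fun x hx => ?_)
  · ext i j
    simp [gram_apply, mul_comm]
  rw [star_trivial, dotProduct_gram_mulVec]
  have hnn : ∀ e ∈ E, 0 ≤ w e * ((incVec ℝ r e ⬝ᵥ x) * (incVec ℝ r e ⬝ᵥ x)) :=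
    fun e _ => mul_nonneg (hw e).le (mul_self_nonneg _)
  refine lt_of_le_of_ne (Finset.sum_nonneg hnn) fun h0 => hx ?_
  -- The extension of `x` by zero at the root.
  let X : V → ℝ := fun v => if h : v ≠ r then x ⟨v, h⟩ else 0
  have hXr : X r = 0 := by simp [X]
  have hXx : (fun i : {v : V // v ≠ r} => X i) = x := by
    ext i
    simp [X, i.2]
  have hedge : ∀ e ∈ E, X (Quot.out e.1).1 = X (Quot.out e.1).2 := by
    intro e he
    have h := (Finset.sum_eq_zero_iff_of_nonneg hnn).1 h0.symm e he
    rw [mul_eq_zero, mul_self_eq_zero, or_iff_right (hw e).ne', ← hXx,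
      incVec_dotProduct e X hXr] at h
    exact sub_eq_zero.1 h
  rw [← hXx]
  ext i
  rw [eq_of_connected_of_edge_eq hE X hedge i r, hXr, Pi.zero_apply]

/-- The Gram determinant of a disconnected edge set vanishes: the indicator of the
vertices not reachable from the root is a null vector. -/
theorem det_gram_incVec_eq_zero {S : Finset (CompleteEdge V)} {r : V}
    (hS : ¬ (graphOf S).Connected) : (gram (incVec ℤ r) 1 S).det = 0 := by
  classical
  obtain ⟨v, hv⟩ : ∃ v, ¬ (graphOf S).Reachable r v := by
    by_contra! h
    exact hS ((SimpleGraph.connected_iff_exists_forall_reachable _).2 ⟨r, h⟩)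
  let X : V → ℤ := fun v => if (graphOf S).Reachable r v then 0 else 1
  have hXr : X r = 0 := if_pos (SimpleGraph.Reachable.refl r)
  have hvr : v ≠ r := by
    rintro rfl
    exact hv (SimpleGraph.Reachable.refl v)
  refine exists_mulVec_eq_zero_iff.1 ⟨fun i => X i, fun h => ?_, ?_⟩
  · have := congrFun h ⟨v, hvr⟩
    simp [X, hv] at this
  · refine dotProduct_eq_zero _ fun y => ?_
    rw [dotProduct_comm, dotProduct_gram_mulVec]
    refine Finset.sum_eq_zero fun e he => ?_
    have hadj : (graphOf S).Adj (Quot.out e.1).1 (Quot.out e.1).2 :=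
      graphOf_adj.2 ⟨e, he, (mk_out e).symm⟩
    have hX : X (Quot.out e.1).1 = X (Quot.out e.1).2 := by
      have : (graphOf S).Reachable r (Quot.out e.1).1 ↔
          (graphOf S).Reachable r (Quot.out e.1).2 :=
        ⟨fun h => h.trans hadj.reachable, fun h => h.trans hadj.symm.reachable⟩
      simp only [X, this]
    rw [incVec_dotProduct e X hXr, hX, sub_self, mul_zero, mul_zero]

/-- Unimodularity: walking from the root to `v` writes the unit vector at `v` as an integral
combination of incidence vectors, so the square incidence matrix of a connected edge set has an
integral left inverse. -/
theorem det_gram_incVec_eq_one {S : Finset (CompleteEdge V)} {r : V}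
    (hS : (graphOf S).Connected) (hcard : S.card = Fintype.card {v : V // v ≠ r}) :
    (gram (incVec ℤ r) 1 S).det = 1 := by
  have g : {v : V // v ≠ r} ≃ S := Fintype.equivOfCardEq (by rw [Fintype.card_coe, hcard])
  rw [det_gram_one_eq_sq _ S g]
  set M : Matrix {v : V // v ≠ r} {v : V // v ≠ r} ℤ := of fun i => incVec ℤ r (g i) with hM
  let δ : V → {v : V // v ≠ r} → ℤ := fun v i => if v = i then 1 else 0
  have hstep : ∀ a b, (graphOf S).Adj a b → (∃ c, c ᵥ* M = δ a) → ∃ c, c ᵥ* M = δ b := by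
    rintro a b hab ⟨c, hc⟩
    obtain ⟨e, he, h⟩ := graphOf_adj.1 hab
    have hrow : Pi.single (g.symm ⟨e, he⟩) 1 ᵥ* M = δ (Quot.out e.1).1 - δ (Quot.out e.1).2 := by
      rw [single_one_vecMul]
      ext i
      simp [hM, incVec, δ]
    rw [← mk_out e, Sym2.eq_iff] at h
    rcases h with ⟨h1, h2⟩ | ⟨h1, h2⟩
    · exact ⟨c - Pi.single (g.symm ⟨e, he⟩) 1, by rw [sub_vecMul, hrow, hc, h1, h2]; abel⟩
    · exact ⟨c + Pi.single (g.symm ⟨e, he⟩) 1, by rw [add_vecMul, hrow, hc, h1, h2]; abel⟩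
  have hwalk : ∀ a b, (graphOf S).Walk a b → (∃ c, c ᵥ* M = δ a) → ∃ c, c ᵥ* M = δ b := by
    intro a b p
    induction p with
    | nil => exact id
    | cons h _ ih => exact fun ha => ih (hstep _ _ h ha)
  have hroot : ∃ c, c ᵥ* M = δ r := by
    refine ⟨0, ?_⟩
    rw [zero_vecMul]
    ext i
    simp [δ, Ne.symm i.2]
  have hall : ∀ v, ∃ c, c ᵥ* M = δ v := fun v =>
    (hS.preconnected r v).elim fun p => hwalk r v p hroot
  choose c hc using hall
  have hinv : (of fun i : {v : V // v ≠ r} => c i) * M = 1 := by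
    ext i j
    have := congrFun (hc i) j
    simpa [δ, mul_apply, vecMul, dotProduct, one_apply, Subtype.ext_iff] using this
  have hdet := congrArg det hinv
  rw [det_mul, det_one] at hdet
  exact Int.isUnit_sq (IsUnit.of_mul_eq_one_right _ hdet)

/-! ### The weighted matrix-tree theorem -/

open scoped Classical in
theorem weightedTreeCount_graphOf (w : CompleteEdge V → ℝ) (E : Finset (CompleteEdge V)) :
    weightedTreeCount w (graphOf E) =
      ∑ S ∈ E.powerset with (graphOf S).IsTree, ∏ e ∈ S, w e := by
  symm
  refine Finset.sum_bij (fun S _ => graphOf S) ?_ ?_ ?_ ?_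
  · intro S hS
    rw [Finset.mem_filter, Finset.mem_powerset] at hS
    simpa [spanningTrees] using ⟨graphOf_mono hS.1, hS.2⟩
  · intro S _ S' _ h
    ext e
    rw [← mem_edgeSet_graphOf, h, mem_edgeSet_graphOf]
  · intro T hT
    simp only [spanningTrees, Finset.mem_filter, Finset.mem_univ, true_and] at hT
    have hT' : graphOf {e : CompleteEdge V | e.1 ∈ T.edgeSet} = T := by
      ext a b
      rw [graphOf_adj]
      constructor
      · rintro ⟨e, he, h⟩
        rw [Finset.mem_filter, h] at he
        exact he.2
      · intro h
        exact ⟨⟨s(a, b), by simpa using h.ne⟩, by simpa using h, rfl⟩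
    refine ⟨({e : CompleteEdge V | e.1 ∈ T.edgeSet} : Finset _), ?_, hT'⟩
    rw [Finset.mem_filter, Finset.mem_powerset, hT']
    refine ⟨fun e he => ?_, hT.2⟩
    rw [Finset.mem_filter] at he
    exact mem_edgeSet_graphOf.1 (SimpleGraph.edgeSet_mono hT.1 he.2)
  · intro S _
    rw [treeValue]
    refine Finset.prod_congr ?_ fun _ _ => rfl
    ext e
    simp [mem_edgeSet_graphOf]

/-- Kirchhoff's weighted matrix-tree theorem: the principal cofactor of the Laplacian at any vertex
`r` is the weighted number of spanning trees. -/
theorem weightedTreeCount_eq_det (w : CompleteEdge V → ℝ) (E : Finset (CompleteEdge V)) (r : V) :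
    weightedTreeCount w (graphOf E) = (gram (incVec ℝ r) w E).det := by
  classical
  have hcardV : Fintype.card {v : V // v ≠ r} + 1 = Fintype.card V := by
    have := Fintype.card_pos_iff.2 ⟨r⟩
    rw [Fintype.card_subtype_compl, Fintype.card_subtype_eq]
    omega
  have htree : ∀ S : Finset (CompleteEdge V), (graphOf S).IsTree ↔
      (graphOf S).Connected ∧ S.card = Fintype.card {v : V // v ≠ r} := by
    intro S
    rw [SimpleGraph.isTree_iff_connected_and_card, ncard_edgeSet_graphOf, Nat.card_eq_fintype_card,
      ← hcardV, add_left_inj]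
  have hcast : ∀ S : Finset (CompleteEdge V),
      (gram (incVec ℝ r) 1 S).det = ((gram (incVec ℤ r) 1 S).det : ℝ) := by
    intro S
    rw [← eq_intCast (Int.castRingHom ℝ), RingHom.map_det]
    congr 1
    ext i j
    simp [gram_apply, incVec]
  rw [weightedTreeCount_graphOf, det_gram_eq_sum_powersetCard, Finset.powersetCard_eq_filter,
    Finset.sum_filter, Finset.sum_filter]
  refine Finset.sum_congr rfl fun S _ => ?_
  by_cases hc : S.card = Fintype.card {v : V // v ≠ r}
  · rw [if_pos hc, hcast]
    by_cases hS : (graphOf S).Connected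
    · rw [if_pos ((htree S).2 ⟨hS, hc⟩), det_gram_incVec_eq_one hS hc, Int.cast_one, mul_one]
    · rw [if_neg fun h => hS ((htree S).1 h).1, det_gram_incVec_eq_zero hS, Int.cast_zero, mul_zero]
  · rw [if_neg hc, if_neg fun h => hc ((htree S).1 h).2]

/-! ### Monotonicity and submodularity -/

theorem treeConnectivity_eq_log_det {E : Finset (CompleteEdge V)} (hE : (graphOf E).Connected)
    {w : CompleteEdge V → ℝ} (hw : ∀ e, 0 < w e) (r : V) :
    treeConnectivity w (graphOf E) = Real.log (gram (incVec ℝ r) w E).det := by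
  rw [treeConnectivity, weightedTreeCount_eq_det w E r, if_pos (det_gram_incVec_pos hE hw r)]

omit [DecidableEq V] in
theorem weightedTreeCount_mono {w : CompleteEdge V → ℝ} (hw : ∀ e, 0 < w e)
    {G H : SimpleGraph V} (h : G ≤ H) : weightedTreeCount w G ≤ weightedTreeCount w H := by
  refine Finset.sum_le_sum_of_subset_of_nonneg (fun T hT => ?_)
    fun T _ _ => Finset.prod_nonneg fun e _ => (hw e).le
  simp only [spanningTrees, Finset.mem_filter, Finset.mem_univ, true_and] at hT ⊢
  exact ⟨hT.1.trans h, hT.2⟩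

/-- Adding an edge multiplies the tree count by `1` plus the product of the weight of the edge and
the effective resistance between its ends. -/
theorem treeConnectivity_insert_sub {E : Finset (CompleteEdge V)} (hE : (graphOf E).Connected)
    {w : CompleteEdge V → ℝ} (hw : ∀ e, 0 < w e) (r : V) {s : CompleteEdge V} (hs : s ∉ E) :
    0 < 1 + w s * (incVec ℝ r s ⬝ᵥ ((gram (incVec ℝ r) w E)⁻¹ *ᵥ incVec ℝ r s)) ∧
    treeConnectivity w (graphOf (insert s E)) - treeConnectivity w (graphOf E) =
      Real.log (1 + w s * (incVec ℝ r s ⬝ᵥ ((gram (incVec ℝ r) w E)⁻¹ *ᵥ incVec ℝ r s))) := by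
  have hE' : (graphOf (insert s E)).Connected := hE.mono (graphOf_mono (Finset.subset_insert s E))
  have hpos := det_gram_incVec_pos hE hw r
  have hpos' := det_gram_incVec_pos hE' hw r
  have hins := det_gram_insert (incVec ℝ r) w hs hpos.ne'
  have hfac := pos_of_mul_pos_right (hins ▸ hpos') hpos.le
  refine ⟨hfac, ?_⟩
  rw [treeConnectivity_eq_log_det hE hw r, treeConnectivity_eq_log_det hE' hw r, hins,
    Real.log_mul hpos.ne' hfac.ne', add_sub_cancel_left]

/-- The marginal gain of an edge is diminishing, as its effective resistance does not increase when
edges are added to the graph. -/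
theorem treeConnectivity_insert_sub_antitone {A B : Finset (CompleteEdge V)} (hAB : A ⊆ B)
    (hA : (graphOf A).Connected) {w : CompleteEdge V → ℝ} (hw : ∀ e, 0 < w e)
    {s : CompleteEdge V} (hs : s ∉ B) :
    treeConnectivity w (graphOf (insert s B)) - treeConnectivity w (graphOf B) ≤
      treeConnectivity w (graphOf (insert s A)) - treeConnectivity w (graphOf A) := by
  obtain ⟨r⟩ := hA.nonempty
  have hB : (graphOf B).Connected := hA.mono (graphOf_mono hAB)
  obtain ⟨hposB, hgainB⟩ := treeConnectivity_insert_sub hB hw r hs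
  obtain ⟨-, hgainA⟩ := treeConnectivity_insert_sub hA hw r fun h => hs (hAB h)
  rw [hgainA, hgainB]
  refine Real.log_le_log hposB (add_le_add_right (mul_le_mul_of_nonneg_left ?_ (hw s).le) 1)
  exact dotProduct_gram_inv_antitone _ w hw hAB (det_gram_incVec_pos hA hw r).ne'
    (det_gram_incVec_pos hB hw r).ne' _

theorem treeConnectivity_mono {A B : Finset (CompleteEdge V)} (hAB : A ⊆ B)
    (hA : (graphOf A).Connected) {w : CompleteEdge V → ℝ} (hw : ∀ e, 0 < w e) :
    treeConnectivity w (graphOf A) ≤ treeConnectivity w (graphOf B) := by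
  obtain ⟨r⟩ := hA.nonempty
  have hB : (graphOf B).Connected := hA.mono (graphOf_mono hAB)
  rw [treeConnectivity_eq_log_det hA hw r, treeConnectivity_eq_log_det hB hw r]
  refine Real.log_le_log (det_gram_incVec_pos hA hw r) ?_
  rw [← weightedTreeCount_eq_det, ← weightedTreeCount_eq_det]
  exact weightedTreeCount_mono hw (graphOf_mono hAB)

end Incidence

end TreeConnectivity

theorem mainTheorem1 {V : Type*} [Fintype V] [DecidableEq V] (hV : 2 ≤ Fintype.card V)
    (Einit : Finset (TreeConnectivity.CompleteEdge V))
    (hconn : (TreeConnectivity.graphOf Einit).Connected)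
    (w : TreeConnectivity.CompleteEdge V → ℝ) (hw : ∀ e, 0 < w e) :
    TreeConnectivity.IsNormalized (TreeConnectivity.logTG Einit w) ∧
      TreeConnectivity.IsMonotone (TreeConnectivity.logTG Einit w) ∧
      TreeConnectivity.IsSubmodular (TreeConnectivity.logTG Einit w) := by
  refine ⟨?_, fun A B hAB => ?_, fun A B hAB s hs => ?_⟩
  · simp [TreeConnectivity.IsNormalized, TreeConnectivity.logTG]
  · exact sub_le_sub_right (TreeConnectivity.treeConnectivity_mono
      (Finset.union_subset_union_left hAB)
      (hconn.mono (TreeConnectivity.graphOf_mono Finset.subset_union_right)) hw) _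
  · simp only [TreeConnectivity.logTG, sub_sub_sub_cancel_right]
    have hunion : ∀ E : Finset (TreeConnectivity.CompleteEdge V),
        E ∪ {s} ∪ Einit = insert s (E ∪ Einit) := by
      intro E
      rw [Finset.union_singleton, Finset.insert_union]
    rw [hunion, hunion]
    by_cases hs' : s ∈ Einit
    -- An edge of the base graph has no marginal gain at all.
    · rw [Finset.insert_eq_of_mem (Finset.mem_union_right _ hs'),
        Finset.insert_eq_of_mem (Finset.mem_union_right _ hs'), sub_self, sub_self]
    · exact TreeConnectivity.treeConnectivity_insert_sub_antitone
        (Finset.union_subset_union_left hAB)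
        (hconn.mono (TreeConnectivity.graphOf_mono Finset.subset_union_right)) hw
        (by simp [hs, hs'])
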